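/- **Theorem (state probabilities of the space-fractional Skellam process).** Let $\lambda_1,\lambda_2>0$ and $\alpha_1,\alpha_2\in(0,1)$. Let $N_1,N_2$ be independent homogeneous Poisson processes with intensities $\lambda_1,\lambda_2$, and let $D_{\alpha_1},D_{\alpha_2}$ be independent stable subordinators with indices $\alpha_1,\alpha_2$, i.e. Lévy processes with non-decreasing paths started at $0$ with $\mathbb E[e^{-sD_{\alpha_i}(t)}]=e^{-ts^{\alpha_i}}$ for $s,t\ge 0$; suppose that the pair $(D_{\alpha_1},D_{\alpha_2})$ is independent of the pair $(N_1,N_2)$. Let $$S_{\alpha_1,\alpha_2}(t)=N_1(D_{\alpha_1}(t))-N_2(D_{\alpha_2}(t)),\qquad t\ge 0,$$ be the space-fractional Skellam process. For $\alpha>0$ and real $b,z$ let $${}_1\psi_1\left[\begin{matrix}(1,\alpha);\\(b,\alpha);\end{matrix}\,z\right]=\sum_{r=0}^{\infty}\frac{\Gamma(1+\alpha r)}{\Gamma(b+\alpha r)}\,\frac{z^r}{r!}$$ be the Fox–Wright function, where $1/\Gamma$ is taken to be $0$ at $0,-1,-2,\dots$. Then for every $t\ge 0$ and every $k\in\mathbb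 Z$ the probability $H_k(t)=\mathbb P(S_{\alpha_1,\alpha_2}(t)=k)$ is given as follows. If $k\ge 0$, $$H_k(t)=\sum_{n=0}^{\infty}\frac{(-1)^{k}}{n!\,(n+k)!}\;{}_1\psi_1\left[\begin{matrix}(1,\alpha_1);\\(1-n-k,\alpha_1);\end{matrix}\,-\lambda_1^{\alpha_1}t\right]\;{}_1\psi_1\left[\begin{matrix}(1,\alpha_2);\\(1-n,\alpha_2);\end{matrix}\,-\lambda_2^{\alpha_2}t\right],$$ and if $k<0$, $$H_k(t)=\sum_{n=0}^{\infty}\frac{(-1)^{|k|}}{n!\,(n+|k|)!}\;{}_1\psi_1\left[\begin{matrix}(1,\alpha_1);\\(1-n,\alpha_1);\end{matrix}\,-\lambda_1^{\alpha_1}t\right]\;{}_1\psi_1\left[\begin{matrix}(1,\alpha_2);\\(1-n-|k|,\alpha_2);\end{matrix}\,-\lambda_2^{\alpha_2}t\right].$$ All the series involved (those over $n$, and the Fox–Wright series defining the factors) converge absolutely. -/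

import Mathlib

open MeasureTheory ProbabilityTheory
open scoped NNReal Nat

noncomputable section

/-- The `r`-th term of the Fox-Wright series with upper parameter pairs `u i = (aᵢ, Aᵢ)` and lower
parameter pairs `v j = (bⱼ, Bⱼ)`. Mathlib's `Real.Gamma` takes the value `0` at `0, -1, -2, …` and
`x / 0 = 0`, so a lower factor at a pole of `Γ` contributes `1 / Γ = 0`, as usual. -/
def foxWrightTerm {p q : ℕ} (u : Fin p → ℝ × ℝ) (v : Fin q → ℝ × ℝ) (z : ℝ) (r : ℕ) : ℝ :=
  (∏ i, Real.Gamma ((u i).1 + (u i).2 * r)) / (∏ j, Real.Gamma ((v j).1 + (v j).2 * r)) *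
    (z ^ r / (r ! : ℝ))

/-- The Fox-Wright function `ₚψ_q` (for real parameters and real argument). -/
def foxWright {p q : ℕ} (u : Fin p → ℝ × ℝ) (v : Fin q → ℝ × ℝ) (z : ℝ) : ℝ :=
  ∑' r : ℕ, foxWrightTerm u v z r

/-- `N` is a homogeneous Poisson process with intensity `l` under `P`. -/
structure IsPoissonProcess {Ω : Type*} [MeasurableSpace Ω] (P : Measure Ω) (l : ℝ≥0)
    (N : ℝ≥0 → Ω → ℕ) : Prop where
  measurable : ∀ t, Measurable (N t)
  zero : ∀ᵐ ω ∂P, N 0 ω = 0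
  mono : ∀ᵐ ω ∂P, Monotone fun t => N t ω
  rightCont : ∀ᵐ ω ∂P, ∀ t, ContinuousWithinAt (fun s => N s ω) (Set.Ici t) t
  indepIncrements : HasIndepIncrements (fun t ω => (N t ω : ℝ)) P
  law_increment : ∀ s t, s ≤ t → HasLaw (fun ω => N t ω - N s ω) (poissonMeasure (l * (t - s))) P

/-- `D` is an `a`-stable subordinator under `P`: a Lévy process with non-decreasing paths, started
at `0`, with Laplace transform `𝔼[exp (-x D(t))] = exp (-t x ^ a)`.
Left limits of the paths exist by monotonicity. -/
structure IsStableSubordinator {Ω : Type*} [MeasurableSpace Ω] (P : Measure Ω) (a : ℝ)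
    (D : ℝ≥0 → Ω → ℝ≥0) : Prop where
  measurable : ∀ t, Measurable (D t)
  zero : ∀ᵐ ω ∂P, D 0 ω = 0
  mono : ∀ᵐ ω ∂P, Monotone fun t => D t ω
  rightCont : ∀ᵐ ω ∂P, ∀ t, ContinuousWithinAt (fun s => D s ω) (Set.Ici t) t
  indepIncrements : HasIndepIncrements (fun t ω => (D t ω : ℝ)) P
  statIncrements : ∀ s t, IdentDistrib (fun ω => (D (s + t) ω : ℝ) - D s ω)
    (fun ω => (D t ω : ℝ)) P P
  laplace : ∀ (t : ℝ≥0) (x : ℝ), 0 ≤ x →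
    ∫ ω, Real.exp (-x * D t ω) ∂P = Real.exp (-t * x ^ a)

/-- The process `S(t) = N₁(D₁(t)) - N₂(D₂(t))`. -/
def timeChangedSkellam {Ω : Type*} (N₁ N₂ : ℝ≥0 → Ω → ℕ) (D₁ D₂ : ℝ≥0 → Ω → ℝ≥0)
    (t : ℝ≥0) (ω : Ω) : ℤ :=
  (N₁ (D₁ t ω) ω : ℤ) - (N₂ (D₂ t ω) ω : ℤ)

/-- `S` is the space-fractional Skellam process built from the Poisson processes `N₁, N₂`
with intensities `l₁, l₂` and the stable subordinators `D₁, D₂` with indices `a₁, a₂`.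
Independence of processes is independence of the whole paths, with the product `σ`-algebra. -/
structure IsSpaceFractionalSkellam {Ω : Type*} [MeasurableSpace Ω] (P : Measure Ω)
    (l₁ l₂ : ℝ≥0) (a₁ a₂ : ℝ) (N₁ N₂ : ℝ≥0 → Ω → ℕ) (D₁ D₂ : ℝ≥0 → Ω → ℝ≥0)
    (S : ℝ≥0 → Ω → ℤ) : Prop where
  poisson₁ : IsPoissonProcess P l₁ N₁
  poisson₂ : IsPoissonProcess P l₂ N₂
  stable₁ : IsStableSubordinator P a₁ D₁
  stable₂ : IsStableSubordinator P a₂ D₂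
  indep_poisson : IndepFun (fun ω s => N₁ s ω) (fun ω s => N₂ s ω) P
  indep_stable : IndepFun (fun ω s => D₁ s ω) (fun ω s => D₂ s ω) P
  indep_poisson_stable : IndepFun (fun ω => ((fun s => N₁ s ω), (fun s => N₂ s ω)))
    (fun ω => ((fun s => D₁ s ω), (fun s => D₂ s ω))) P
  eq : S = timeChangedSkellam N₁ N₂ D₁ D₂

end

/-!
At an independent random time `T`, a Poisson process has a mixed Poisson law: its probability of
being in state `m` is `(-l) ^ m / m!` times the `m`-th derivative at `l` of the Laplace transform of
`T`. If that transform is `exp (-c * x ^ a)`, the exponential series can be differentiated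
termwise. The `m`-th derivative of `x ^ (a * r)` produces the falling factorial of `a * r` of order
`m`, which is the quotient `Γ(1 + a r) / Γ(1 - m + a r)`, also at the poles of the denominator, and
the Fox-Wright series appears. The two subordinated processes at a fixed time are independent, so
the probability of the difference `k` is the sum of the products of their state probabilities over
all pairs of states with difference `k`.
-/

open Filter Topology

section FoxWright

theorem gamma_one_add_div_gamma_one_sub_natCast_add {x : ℝ} (hx : -1 < x) (m : ℕ) :
    Real.Gamma (1 + x) / Real.Gamma (1 - m + x) = (descPochhammer ℝ m).eval x := by
  induction m with
  | zero => simp [(Real.Gamma_pos_of_pos (by linarith : 0 < 1 + x)).ne']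
  | succ m ih =>
    have h_shift : 1 - ((m + 1 : ℕ) : ℝ) + x = x - m := by push_cast; ring
    rw [descPochhammer_succ_eval, ← ih, h_shift, show 1 - (m : ℝ) + x = x - m + 1 by ring]
    by_cases h_pole : x - m = 0
    · simp [h_pole]
    · rw [Real.Gamma_add_one h_pole, div_mul_eq_mul_div, mul_comm (Real.Gamma (1 + x)),
        mul_div_mul_left _ _ h_pole]

theorem foxWrightTerm_one_sub_natCast {a : ℝ} (ha : 0 ≤ a) (m : ℕ) (z : ℝ) (r : ℕ) :
    foxWrightTerm ![(1, a)] ![(1 - (m : ℝ), a)] z r =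
      (descPochhammer ℝ m).eval (a * r) * (z ^ r / r !) := by
  have har : -1 < a * r := neg_one_lt_zero.trans_le (by positivity)
  simp [foxWrightTerm, gamma_one_add_div_gamma_one_sub_natCast_add har]

theorem abs_eval_descPochhammer_le (x : ℝ) (m : ℕ) :
    |(descPochhammer ℝ m).eval x| ≤ m ! * Real.exp (|x| + m) := calc
  |(descPochhammer ℝ m).eval x| = ∏ i ∈ Finset.range m, |x - i| := by
    rw [descPochhammer_eval_eq_prod_range, Finset.abs_prod]
  _ ≤ ∏ _i ∈ Finset.range m, (|x| + m) := by
    refine Finset.prod_le_prod (fun i _ => abs_nonneg _) fun i hi => ?_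
    have him : (i : ℝ) ≤ m := by exact_mod_cast (Finset.mem_range.1 hi).le
    exact (abs_sub x i).trans (by rw [Nat.abs_cast]; gcongr)
  _ = (|x| + m) ^ m := by simp
  _ ≤ m ! * Real.exp (|x| + m) := by
    rw [← div_le_iff₀' (by positivity)]
    exact Real.pow_div_factorial_le_exp _ (by positivity) m

theorem abs_eval_descPochhammer_mul_pow_div_factorial_le (a z : ℝ) (m r : ℕ) :
    |(descPochhammer ℝ m).eval (a * r) * (z ^ r / r !)| ≤
      m ! * Real.exp m * ((Real.exp |a| * |z|) ^ r / r !) := calc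
  |(descPochhammer ℝ m).eval (a * r) * (z ^ r / r !)|
    = |(descPochhammer ℝ m).eval (a * r)| * (|z| ^ r / r !) := by
      rw [abs_mul, abs_div, abs_pow, Nat.abs_cast]
  _ ≤ m ! * Real.exp (|a * r| + m) * (|z| ^ r / r !) := by
      gcongr
      exact abs_eval_descPochhammer_le _ _
  _ = m ! * Real.exp m * ((Real.exp |a| * |z|) ^ r / r !) := by
      rw [Real.exp_add, abs_mul, Nat.abs_cast, mul_comm |a|, Real.exp_nat_mul, mul_pow]
      ring

theorem summable_eval_descPochhammer_mul_pow_div_factorial (a z : ℝ) (m : ℕ) :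
    Summable fun r : ℕ => (descPochhammer ℝ m).eval (a * r) * (z ^ r / r !) :=
  .of_norm_bounded ((Real.summable_pow_div_factorial _).mul_left _)
    (abs_eval_descPochhammer_mul_pow_div_factorial_le a z m)

theorem summable_foxWrightTerm_one_sub_natCast {a : ℝ} (ha : 0 ≤ a) (m : ℕ) (z : ℝ) :
    Summable (foxWrightTerm ![(1, a)] ![(1 - (m : ℝ), a)] z) :=
  (summable_eval_descPochhammer_mul_pow_div_factorial a z m).congr fun r =>
    (foxWrightTerm_one_sub_natCast ha m z r).symm

/-- The `r`-th term of the exponential series for `exp (c * x ^ a)`, with `(x ^ a) ^ r` written as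
the single power `x ^ (a * r)` so that it can be differentiated in `x`. -/
noncomputable def expRpowTerm (c a : ℝ) (r : ℕ) (x : ℝ) : ℝ :=
  c ^ r / r ! * x ^ (a * r)

theorem tsum_expRpowTerm (c a : ℝ) {x : ℝ} (hx : 0 < x) :
    ∑' r, expRpowTerm c a r x = Real.exp (c * x ^ a) := by
  rw [Real.exp_eq_exp_ℝ, NormedSpace.exp_eq_tsum_div]
  refine tsum_congr fun r => ?_
  rw [expRpowTerm, Real.rpow_mul_natCast hx.le, mul_pow]
  ring

theorem iteratedDeriv_expRpowTerm (c a : ℝ) (r m : ℕ) {x : ℝ} (hx : 0 < x) :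
    iteratedDeriv m (expRpowTerm c a r) x =
      (descPochhammer ℝ m).eval (a * r) * ((c * x ^ a) ^ r / r !) / x ^ m := by
  have h_rpow : iteratedDeriv m (fun y : ℝ => y ^ (a * r)) x =
      (descPochhammer ℝ m).eval (a * r) * x ^ (a * r - m) := by
    rw [iteratedDeriv_eq_iterate, Real.iter_deriv_rpow_const]
  unfold expRpowTerm
  rw [iteratedDeriv_const_mul_field, h_rpow, Real.rpow_sub_natCast hx.ne',
    Real.rpow_mul_natCast hx.le, mul_pow]
  ring

theorem contDiffOn_expRpowTerm (c a : ℝ) (r : ℕ) {n : WithTop ℕ∞} :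
    ContDiffOn ℝ n (expRpowTerm c a r) (Set.Ioi 0) :=
  contDiffOn_const.mul (contDiffOn_id.rpow_const_of_ne fun _ hx => (Set.mem_Ioi.1 hx).ne')

theorem summableLocallyUniformlyOn_iteratedDeriv_expRpowTerm (c a : ℝ) (m : ℕ) :
    SummableLocallyUniformlyOn (fun r => iteratedDeriv m (expRpowTerm c a r)) (Set.Ioi 0) := by
  refine SummableLocallyUniformlyOn_of_locally_bounded isOpen_Ioi fun K hK hK_compact => ?_
  have hK_ne : ∀ x ∈ K, x ≠ 0 := fun x hx => (hK hx).ne'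
  obtain ⟨A, hA⟩ := hK_compact.exists_bound_of_continuousOn (f := fun x : ℝ => c * x ^ a)
    (continuousOn_const.mul (continuousOn_id.rpow_const fun x hx => .inl (hK_ne x hx)))
  obtain ⟨B, hB⟩ := hK_compact.exists_bound_of_continuousOn (f := fun x : ℝ => (x ^ m)⁻¹)
    ((continuousOn_id.pow m).inv₀ fun x hx => pow_ne_zero m (hK_ne x hx))
  refine ⟨fun r => m ! * Real.exp m * ((Real.exp |a| * A) ^ r / r !) * B,
    ((Real.summable_pow_div_factorial _).mul_left _).mul_right B, fun r x hx => ?_⟩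
  rw [iteratedDeriv_expRpowTerm c a r m (hK hx), div_eq_mul_inv, norm_mul]
  refine mul_le_mul ((abs_eval_descPochhammer_mul_pow_div_factorial_le a _ m r).trans ?_)
    (hB x hx) (norm_nonneg _) ?_
  · gcongr
    exact hA x hx
  · have := (norm_nonneg _).trans (hA x hx)
    positivity

theorem iteratedDeriv_exp_mul_rpow (c a : ℝ) (m : ℕ) {x : ℝ} (hx : 0 < x) :
    iteratedDeriv m (fun y => Real.exp (c * y ^ a)) x =
      ∑' r, iteratedDeriv m (expRpowTerm c a r) x := by
  have h_within (k r : ℕ) : Set.EqOn (iteratedDerivWithin k (expRpowTerm c a r) (Set.Ioi 0))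
      (iteratedDeriv k (expRpowTerm c a r)) (Set.Ioi 0) := iteratedDerivWithin_of_isOpen isOpen_Ioi
  have h_sum (k : ℕ) := summableLocallyUniformlyOn_iteratedDeriv_expRpowTerm c a k
  calc iteratedDeriv m (fun y => Real.exp (c * y ^ a)) x
      = iteratedDeriv m (fun y => ∑' r, expRpowTerm c a r y) x := by
        refine EventuallyEq.iteratedDeriv_eq m ?_
        filter_upwards [lt_mem_nhds hx] with y hy using (tsum_expRpowTerm c a hy).symm
    _ = iteratedDerivWithin m (fun y => ∑' r, expRpowTerm c a r y) (Set.Ioi 0) x :=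
        (iteratedDerivWithin_of_isOpen isOpen_Ioi hx).symm
    _ = ∑' r, iteratedDerivWithin m (expRpowTerm c a r) (Set.Ioi 0) x := by
        refine iteratedDerivWithin_tsum m isOpen_Ioi hx
          (fun y hy => by simpa using (h_sum 0).summable hy)
          (fun k _ _ => SummableLocallyUniformlyOn_congr (fun r => (h_within k r).symm) (h_sum k))
          fun r k y _ hy => (((contDiffOn_expRpowTerm c a r).differentiableOn_iteratedDerivWithin
            (WithTop.coe_lt_top (k : ℕ∞)) isOpen_Ioi.uniqueDiffOn).differentiableAt
              (Ioi_mem_nhds hy))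
    _ = ∑' r, iteratedDeriv m (expRpowTerm c a r) x := tsum_congr fun r => h_within m r hx

theorem foxWright_eq_pow_mul_iteratedDeriv_exp {a : ℝ} (ha : 0 ≤ a) (c : ℝ) (m : ℕ) {x : ℝ}
    (hx : 0 < x) :
    foxWright ![(1, a)] ![(1 - (m : ℝ), a)] (c * x ^ a) =
      x ^ m * iteratedDeriv m (fun y => Real.exp (c * y ^ a)) x := by
  rw [iteratedDeriv_exp_mul_rpow c a m hx, ← tsum_mul_left, foxWright]
  refine tsum_congr fun r => ?_
  rw [iteratedDeriv_expRpowTerm c a r m hx, foxWrightTerm_one_sub_natCast ha,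
    mul_div_cancel₀ _ (by positivity)]

end FoxWright

section Independence

variable {α β γ δ : Type*} [MeasurableSpace α] [MeasurableSpace β] [MeasurableSpace γ]
  [MeasurableSpace δ]

theorem measurePreserving_prodProdProdComm (μ₁ : Measure α) (μ₂ : Measure β) (ν₁ : Measure γ)
    (ν₂ : Measure δ) [SigmaFinite μ₁] [SigmaFinite μ₂] [SigmaFinite ν₁] [SigmaFinite ν₂] :
    MeasurePreserving (Equiv.prodProdProdComm α β γ δ) ((μ₁.prod μ₂).prod (ν₁.prod ν₂))
      ((μ₁.prod ν₁).prod (μ₂.prod ν₂)) := by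
  have h_meas : Measurable (Equiv.prodProdProdComm α β γ δ) := by
    simp only [Equiv.prodProdProdComm, Equiv.coe_fn_mk]
    fun_prop
  refine ⟨h_meas, (Measure.prod_eq fun s t hs ht => ?_).symm⟩
  calc ((μ₁.prod μ₂).prod (ν₁.prod ν₂)).map (Equiv.prodProdProdComm α β γ δ) (s ×ˢ t)
      = ∫⁻ q, μ₁ ((fun x => (x, q.1)) ⁻¹' s) * μ₂ ((fun y => (y, q.2)) ⁻¹' t) ∂ν₁.prod ν₂ := by
        rw [Measure.map_apply h_meas (hs.prod ht), Measure.prod_apply_symm (h_meas (hs.prod ht))]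
        exact lintegral_congr fun q =>
          Measure.prod_prod ((fun x => (x, q.1)) ⁻¹' s) ((fun y => (y, q.2)) ⁻¹' t)
    _ = (μ₁.prod ν₁) s * (μ₂.prod ν₂) t := by
        rw [lintegral_prod_mul (measurable_measure_prodMk_right hs).aemeasurable
          (measurable_measure_prodMk_right ht).aemeasurable, Measure.prod_apply_symm hs,
          Measure.prod_apply_symm ht]

theorem indepFun_prodMk_prodMk {Ω : Type*} [MeasurableSpace Ω] {P : Measure Ω} [IsFiniteMeasure P]
    {X : Ω → α} {Y : Ω → β} {T : Ω → γ} {U : Ω → δ} (hX : AEMeasurable X P)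
    (hY : AEMeasurable Y P) (hT : AEMeasurable T P) (hU : AEMeasurable U P)
    (hXY : IndepFun X Y P) (hTU : IndepFun T U P)
    (hXY_TU : IndepFun (fun ω => (X ω, Y ω)) (fun ω => (T ω, U ω)) P) :
    IndepFun (fun ω => (X ω, T ω)) (fun ω => (Y ω, U ω)) P := by
  have hXT : IndepFun X T P := hXY_TU.comp measurable_fst measurable_fst
  have hYU : IndepFun Y U P := hXY_TU.comp measurable_snd measurable_snd
  have h_regroup := measurePreserving_prodProdProdComm (P.map X) (P.map Y) (P.map T) (P.map U)
  rw [indepFun_iff_map_prod_eq_prod_map_map (hX.prodMk hT) (hY.prodMk hU),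
    hXT.map_prod_eq_prod_map_map hX hT, hYU.map_prod_eq_prod_map_map hY hU, ← h_regroup.map_eq,
    ← hXY.map_prod_eq_prod_map_map hX hY, ← hTU.map_prod_eq_prod_map_map hT hU,
    ← hXY_TU.map_prod_eq_prod_map_map (hX.prodMk hY) (hT.prodMk hU),
    AEMeasurable.map_map_of_aemeasurable h_regroup.measurable.aemeasurable
      ((hX.prodMk hY).prodMk (hT.prodMk hU))]
  rfl

end Independence

section RandomTime

/-- The least multiple of `1 / (j + 1)` that is greater than `d`: an approximation of `d` from the
right with countably many values, so that evaluating a path at it is jointly measurable. -/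
noncomputable def rightApprox (j : ℕ) (d : ℝ≥0) : ℝ≥0 := (⌊(j + 1) * d⌋₊ + 1) / (j + 1)

theorem le_rightApprox (j : ℕ) (d : ℝ≥0) : d ≤ rightApprox j d := by
  rw [rightApprox, le_div_iff₀ (by positivity), mul_comm]
  exact (Nat.lt_floor_add_one _).le

theorem rightApprox_le (j : ℕ) (d : ℝ≥0) : rightApprox j d ≤ d + 1 / (j + 1) := by
  rw [rightApprox, div_le_iff₀ (by positivity), add_mul d, div_mul_cancel₀ _ (by positivity),
    mul_comm d]
  gcongr
  exact Nat.floor_le (by positivity)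

theorem tendsto_rightApprox (d : ℝ≥0) :
    Tendsto (fun j => rightApprox j d) atTop (𝓝[≥] d) := by
  refine tendsto_nhdsWithin_iff.2 ⟨?_, Eventually.of_forall fun j => le_rightApprox j d⟩
  have h_upper : Tendsto (fun j : ℕ => d + 1 / ((j : ℝ≥0) + 1)) atTop (𝓝 d) := by
    simpa using tendsto_const_nhds.add (tendsto_one_div_add_atTop_nhds_zero_nat (𝕜 := ℝ≥0))
  exact tendsto_of_tendsto_of_tendsto_of_le_of_le tendsto_const_nhds h_upper
    (fun j => le_rightApprox j d) (fun j => rightApprox_le j d)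

/-- A jointly measurable map on the full product space of paths and times which agrees with the
evaluation `(x, d) ↦ x d` on right-continuous paths; the evaluation itself is not measurable for the
product `σ`-algebra. -/
noncomputable def rightEval {E : Type*} [TopologicalSpace E] [Nonempty E]
    (p : (ℝ≥0 → E) × ℝ≥0) : E :=
  limUnder atTop fun j => p.1 (rightApprox j p.2)

theorem rightEval_eq {E : Type*} [TopologicalSpace E] [T2Space E] [Nonempty E] {x : ℝ≥0 → E}
    {d : ℝ≥0} (hx : ContinuousWithinAt x (Set.Ici d) d) : rightEval (x, d) = x d :=
  (hx.tendsto.comp (tendsto_rightApprox d)).limUnder_eq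

theorem rightEval_ae_eq {E Ω : Type*} [TopologicalSpace E] [T2Space E] [Nonempty E]
    [MeasurableSpace Ω] {P : Measure Ω} {X : ℝ≥0 → Ω → E}
    (hX_right : ∀ᵐ ω ∂P, ∀ d, ContinuousWithinAt (X · ω) (Set.Ici d) d) (T : Ω → ℝ≥0) :
    (fun ω => rightEval ((X · ω), T ω)) =ᵐ[P] fun ω => X (T ω) ω := by
  filter_upwards [hX_right] with ω hω using rightEval_eq (hω (T ω))

variable {E F : Type*} [TopologicalSpace E] [PolishSpace E] [Nonempty E] [MeasurableSpace E]
  [BorelSpace E] [TopologicalSpace F] [PolishSpace F] [Nonempty F] [MeasurableSpace F]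
  [BorelSpace F]

theorem measurable_rightEval : Measurable (rightEval : (ℝ≥0 → E) × ℝ≥0 → E) := by
  refine (StronglyMeasurable.limUnder fun j => Measurable.stronglyMeasurable ?_).measurable
  have h_grid : Measurable fun q : (ℝ≥0 → E) × ℕ => q.1 ((q.2 + 1) / (j + 1)) :=
    measurable_from_prod_countable_left fun i =>
      measurable_pi_apply (((i : ℝ≥0) + 1) / (j + 1))
  have h_floor : Measurable fun p : (ℝ≥0 → E) × ℝ≥0 => (p.1, ⌊(j + 1) * p.2⌋₊) := by fun_prop
  exact h_grid.comp h_floor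

variable {Ω : Type*} [MeasurableSpace Ω] {P : Measure Ω} {X : ℝ≥0 → Ω → E} {Y : ℝ≥0 → Ω → F}
  {T U : Ω → ℝ≥0}

theorem aemeasurable_randomTime (hX : ∀ d, Measurable (X d))
    (hX_right : ∀ᵐ ω ∂P, ∀ d, ContinuousWithinAt (X · ω) (Set.Ici d) d) (hT : AEMeasurable T P) :
    AEMeasurable (fun ω => X (T ω) ω) P :=
  (measurable_rightEval.comp_aemeasurable
    ((measurable_pi_lambda _ hX).aemeasurable.prodMk hT)).congr (rightEval_ae_eq hX_right T)

theorem measure_randomTime_mem [IsFiniteMeasure P] (hX : ∀ d, Measurable (X d))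
    (hX_right : ∀ᵐ ω ∂P, ∀ d, ContinuousWithinAt (X · ω) (Set.Ici d) d) (hT : AEMeasurable T P)
    (hXT : IndepFun (fun ω d => X d ω) T P) {s : Set E} (hs : MeasurableSet s) :
    P {ω | X (T ω) ω ∈ s} = ∫⁻ ω, P {ω' | X (T ω) ω' ∈ s} ∂P := by
  have h_path : Measurable fun ω d => X d ω := measurable_pi_lambda _ hX
  have h_pre : MeasurableSet (rightEval ⁻¹' s : Set ((ℝ≥0 → E) × ℝ≥0)) := measurable_rightEval hs
  have h_rightEval (V : Ω → ℝ≥0) :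
      P {ω | X (V ω) ω ∈ s} = P ((fun ω => ((X · ω), V ω)) ⁻¹' (rightEval ⁻¹' s)) := by
    refine measure_congr ?_
    filter_upwards [rightEval_ae_eq hX_right V] with ω hω
    exact congrArg (· ∈ s) hω.symm
  calc P {ω | X (T ω) ω ∈ s}
      = P.map (fun ω => ((X · ω), T ω)) (rightEval ⁻¹' s) := by
        rw [h_rightEval, Measure.map_apply_of_aemeasurable (h_path.aemeasurable.prodMk hT) h_pre]
    _ = ∫⁻ ω, P.map (fun ω d => X d ω) ((fun x => (x, T ω)) ⁻¹' (rightEval ⁻¹' s)) ∂P := by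
        rw [hXT.map_prod_eq_prod_map_map h_path.aemeasurable hT, Measure.prod_apply_symm h_pre,
          lintegral_map' (measurable_measure_prodMk_right h_pre).aemeasurable hT]
    _ = ∫⁻ ω, P {ω' | X (T ω) ω' ∈ s} ∂P := by
        refine lintegral_congr fun ω => ?_
        rw [Measure.map_apply h_path (measurable_prodMk_right h_pre)]
        exact (h_rightEval fun _ => T ω).symm

theorem indepFun_randomTime [IsFiniteMeasure P] (hX : ∀ d, Measurable (X d))
    (hX_right : ∀ᵐ ω ∂P, ∀ d, ContinuousWithinAt (X · ω) (Set.Ici d) d)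
    (hY : ∀ d, Measurable (Y d))
    (hY_right : ∀ᵐ ω ∂P, ∀ d, ContinuousWithinAt (Y · ω) (Set.Ici d) d)
    (hT : AEMeasurable T P) (hU : AEMeasurable U P)
    (hXY : IndepFun (fun ω d => X d ω) (fun ω d => Y d ω) P) (hTU : IndepFun T U P)
    (hXY_TU : IndepFun (fun ω => ((X · ω), (Y · ω))) (fun ω => (T ω, U ω)) P) :
    IndepFun (fun ω => X (T ω) ω) (fun ω => Y (U ω) ω) P :=
  ((indepFun_prodMk_prodMk (measurable_pi_lambda _ hX).aemeasurable
    (measurable_pi_lambda _ hY).aemeasurable hT hU hXY hTU hXY_TU).comp measurable_rightEval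
      measurable_rightEval).congr (rightEval_ae_eq hX_right T) (rightEval_ae_eq hY_right U)

end RandomTime

section MixedPoisson

variable {Ω : Type*} [MeasurableSpace Ω] {P : Measure Ω}

theorem iteratedDeriv_integral_exp_neg_mul [IsFiniteMeasure P] {X : Ω → ℝ≥0}
    (hX : AEMeasurable X P) (m : ℕ) {l : ℝ} (hl : 0 < l) :
    iteratedDeriv m (fun x => ∫ ω, Real.exp (-x * X ω) ∂P) l =
      ∫ ω, (-(X ω : ℝ)) ^ m * Real.exp (-l * X ω) ∂P := by
  have h_mgf : (fun x => ∫ ω, Real.exp (-x * X ω) ∂P) = mgf (fun ω => -(X ω : ℝ)) P := by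
    ext x
    simp only [mgf, neg_mul, mul_neg]
  have h_integrable : Set.Ioi 0 ⊆ integrableExpSet (fun ω => -(X ω : ℝ)) P := fun x hx => by
    refine Integrable.of_bound (C := 1) (AEMeasurable.aestronglyMeasurable (by fun_prop))
      (ae_of_all _ fun ω => ?_)
    rw [Real.norm_eq_abs, Real.abs_exp, Real.exp_le_one_iff, mul_neg, neg_nonpos]
    exact mul_nonneg (le_of_lt hx) (X ω).coe_nonneg
  rw [h_mgf, iteratedDeriv_mgf (mem_interior.2 ⟨_, h_integrable, isOpen_Ioi, hl⟩)]
  simp only [mul_neg, neg_mul]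

/-- `N` has right-continuous paths and `N d` is Poisson distributed with mean `l * d`. This is all
that determines the law of `N` at an independent random time. -/
structure HasPoissonMarginals (P : Measure Ω) (l : ℝ≥0) (N : ℝ≥0 → Ω → ℕ) : Prop where
  measurable : ∀ d, Measurable (N d)
  rightCont : ∀ᵐ ω ∂P, ∀ d, ContinuousWithinAt (N · ω) (Set.Ici d) d
  hasLaw : ∀ d, HasLaw (N d) (poissonMeasure (l * d)) P

theorem IsPoissonProcess.hasPoissonMarginals {l : ℝ≥0} {N : ℝ≥0 → Ω → ℕ}
    (hN : IsPoissonProcess P l N) : HasPoissonMarginals P l N where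
  measurable := hN.measurable
  rightCont := hN.rightCont
  hasLaw d := by
    have h_law := hN.law_increment 0 d zero_le
    rw [tsub_zero] at h_law
    refine h_law.congr ?_
    filter_upwards [hN.zero] with ω hω
    rw [hω, Nat.sub_zero]

theorem HasPoissonMarginals.measureReal_randomTime_eq [IsFiniteMeasure P] {l : ℝ≥0}
    {N : ℝ≥0 → Ω → ℕ} (hN : HasPoissonMarginals P l N) {T : Ω → ℝ≥0} (hT : AEMeasurable T P)
    (hNT : IndepFun (fun ω d => N d ω) T P) (m : ℕ) :
    P.real {ω | N (T ω) ω = m} = ∫ ω, Real.exp (-(l * T ω)) * (l * T ω) ^ m / (m ! : ℝ) ∂P := by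
  have h_marginal (d : ℝ≥0) : P {ω | N d ω = m} =
      ENNReal.ofReal (Real.exp (-(l * d)) * (l * d) ^ m / m !) := by
    rw [(hN.hasLaw d).measure_eq (p := (· = m)) .of_discrete, Set.ofPred_eq_eq_singleton,
      poissonMeasure_singleton, NNReal.coe_mul]
  rw [integral_eq_lintegral_of_nonneg_ae (ae_of_all _ fun ω => by positivity)
    (AEMeasurable.aestronglyMeasurable (by fun_prop)), measureReal_def]
  congr 1
  calc P {ω | N (T ω) ω = m} = ∫⁻ ω, P {ω' | N (T ω) ω' = m} ∂P :=
        measure_randomTime_mem hN.measurable hN.rightCont hT hNT (measurableSet_singleton m)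
    _ = ∫⁻ ω, ENNReal.ofReal (Real.exp (-(l * T ω)) * (l * T ω) ^ m / m !) ∂P := by
        simp only [h_marginal]

theorem HasPoissonMarginals.measureReal_randomTime_eq_iteratedDeriv [IsFiniteMeasure P] {l : ℝ≥0}
    (hl : 0 < l) {N : ℝ≥0 → Ω → ℕ} (hN : HasPoissonMarginals P l N) {T : Ω → ℝ≥0}
    (hT : AEMeasurable T P) (hNT : IndepFun (fun ω d => N d ω) T P) (m : ℕ) :
    P.real {ω | N (T ω) ω = m} =
      (-l) ^ m / m ! * iteratedDeriv m (fun x => ∫ ω, Real.exp (-x * T ω) ∂P) l := by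
  rw [hN.measureReal_randomTime_eq hT hNT,
    iteratedDeriv_integral_exp_neg_mul hT m (NNReal.coe_pos.2 hl), ← integral_const_mul]
  refine integral_congr_ae (ae_of_all _ fun ω => ?_)
  beta_reduce
  rw [← neg_mul_neg (l : ℝ), mul_pow, neg_mul_neg, neg_mul]
  ring

/-- `T` is a nonnegative random variable with Laplace transform `exp (-c * x ^ a)`: the law at time
`c` of an `a`-stable subordinator for `0 < a < 1`, and the constant `c` for `a = 1`. -/
structure HasStableLaplace (P : Measure Ω) (a c : ℝ) (T : Ω → ℝ≥0) : Prop where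
  aemeasurable : AEMeasurable T P
  laplace : ∀ x : ℝ, 0 < x → ∫ ω, Real.exp (-x * T ω) ∂P = Real.exp (-c * x ^ a)

theorem IsStableSubordinator.hasStableLaplace {a : ℝ} {D : ℝ≥0 → Ω → ℝ≥0}
    (hD : IsStableSubordinator P a D) (t : ℝ≥0) : HasStableLaplace P a t (D t) where
  aemeasurable := (hD.measurable t).aemeasurable
  laplace x hx := hD.laplace t x hx.le

theorem HasPoissonMarginals.measureReal_stableTime_eq [IsFiniteMeasure P] {l : ℝ≥0}
    (hl : 0 < l) {N : ℝ≥0 → Ω → ℕ} (hN : HasPoissonMarginals P l N) {a c : ℝ} (ha : 0 ≤ a)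
    {T : Ω → ℝ≥0} (hT : HasStableLaplace P a c T) (hNT : IndepFun (fun ω d => N d ω) T P) (m : ℕ) :
    P.real {ω | N (T ω) ω = m} =
      (-1) ^ m / m ! * foxWright ![(1, a)] ![(1 - (m : ℝ), a)] (-(l : ℝ) ^ a * c) := by
  have h_laplace : (fun x => ∫ ω, Real.exp (-x * T ω) ∂P) =ᶠ[𝓝 (l : ℝ)]
      fun x => Real.exp (-c * x ^ a) := by
    filter_upwards [lt_mem_nhds (NNReal.coe_pos.2 hl)] with x hx using hT.laplace x hx
  rw [hN.measureReal_randomTime_eq_iteratedDeriv hl hT.aemeasurable hNT,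
    h_laplace.iteratedDeriv_eq, neg_mul_comm, mul_comm ((l : ℝ) ^ a),
    foxWright_eq_pow_mul_iteratedDeriv_exp ha (-c) m (NNReal.coe_pos.2 hl), neg_pow (l : ℝ)]
  ring

end MixedPoisson

section Difference

variable {Ω : Type*} [MeasurableSpace Ω] {P : Measure Ω}

theorem hasSum_measureReal_iUnion₀ [IsFiniteMeasure P] {ι : Type*} [Countable ι] {s : ι → Set Ω}
    (hs_disj : Pairwise (Function.onFun (AEDisjoint P) s))
    (hs : ∀ i, NullMeasurableSet (s i) P) :
    HasSum (fun i => P.real (s i)) (P.real (⋃ i, s i)) := by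
  have h_tsum := measure_iUnion₀ hs_disj hs
  rw [measureReal_def, h_tsum, ENNReal.tsum_toReal_eq fun i => measure_ne_top P (s i)]
  exact ENNReal.hasSum_toReal (h_tsum ▸ measure_ne_top P _)

theorem hasSum_measureReal_natCast_sub_eq [IsFiniteMeasure P] {X Y : Ω → ℕ}
    (hX : AEMeasurable X P) (hY : AEMeasurable Y P) (hXY : IndepFun X Y P) (k : ℕ) :
    HasSum (fun n => P.real {ω | X ω = n + k} * P.real {ω | Y ω = n})
      (P.real {ω | (X ω : ℤ) - Y ω = k}) := by
  have h_union : {ω | (X ω : ℤ) - Y ω = k} = ⋃ n, X ⁻¹' {n + k} ∩ Y ⁻¹' {n} := by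
    ext ω
    simp only [Set.mem_ofPred_eq, Set.mem_iUnion, Set.mem_inter_iff, Set.mem_preimage,
      Set.mem_singleton_iff, exists_eq_right']
    omega
  have h_disj : Pairwise (Function.onFun (AEDisjoint P) fun n => X ⁻¹' {n + k} ∩ Y ⁻¹' {n}) :=
    fun i j hij => (Set.disjoint_left.2 fun ω hi hj => hij (hi.2.symm.trans hj.2)).aedisjoint
  rw [h_union]
  refine (hasSum_measureReal_iUnion₀ h_disj fun n => ?_).congr_fun fun n => ?_
  · exact (hX.nullMeasurableSet_preimage .of_discrete).inter
      (hY.nullMeasurableSet_preimage .of_discrete)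
  · rw [measureReal_def P (_ ∩ _),
      hXY.measure_inter_preimage_eq_mul _ _ .of_discrete .of_discrete, ENNReal.toReal_mul]
    rfl

end Difference

section SubordinatedPoisson

variable {Ω : Type*} [MeasurableSpace Ω] {P : Measure Ω} {l₁ l₂ : ℝ≥0} {a₁ a₂ c₁ c₂ : ℝ}
  {N₁ N₂ : ℝ≥0 → Ω → ℕ} {T₁ T₂ : Ω → ℝ≥0}

theorem hasSum_foxWright_stableTime_sub_eq [IsFiniteMeasure P] (hl₁ : 0 < l₁) (hl₂ : 0 < l₂)
    (ha₁ : 0 ≤ a₁) (ha₂ : 0 ≤ a₂) (hN₁ : HasPoissonMarginals P l₁ N₁)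
    (hN₂ : HasPoissonMarginals P l₂ N₂) (hT₁ : HasStableLaplace P a₁ c₁ T₁)
    (hT₂ : HasStableLaplace P a₂ c₂ T₂)
    (hN : IndepFun (fun ω d => N₁ d ω) (fun ω d => N₂ d ω) P) (hT : IndepFun T₁ T₂ P)
    (hNT : IndepFun (fun ω => ((N₁ · ω), (N₂ · ω))) (fun ω => (T₁ ω, T₂ ω)) P) (k : ℕ) :
    HasSum (fun n : ℕ =>
      (-1 : ℝ) ^ k / ((n ! : ℝ) * ((n + k)! : ℝ)) *
        foxWright ![(1, a₁)] ![(1 - (n : ℝ) - k, a₁)] (-(l₁ : ℝ) ^ a₁ * c₁) *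
        foxWright ![(1, a₂)] ![(1 - (n : ℝ), a₂)] (-(l₂ : ℝ) ^ a₂ * c₂))
      (P.real {ω | (N₁ (T₁ ω) ω : ℤ) - N₂ (T₂ ω) ω = k}) := by
  have h_indep : IndepFun (fun ω => N₁ (T₁ ω) ω) (fun ω => N₂ (T₂ ω) ω) P :=
    indepFun_randomTime hN₁.measurable hN₁.rightCont hN₂.measurable hN₂.rightCont
      hT₁.aemeasurable hT₂.aemeasurable hN hT hNT
  refine (hasSum_measureReal_natCast_sub_eq
    (aemeasurable_randomTime hN₁.measurable hN₁.rightCont hT₁.aemeasurable)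
    (aemeasurable_randomTime hN₂.measurable hN₂.rightCont hT₂.aemeasurable)
    h_indep k).congr_fun fun n => ?_
  have h_sign : (-1 : ℝ) ^ n * (-1) ^ n = 1 := pow_mul_pow_eq_one n (by norm_num)
  have h_param : 1 - (n : ℝ) - k = 1 - ((n + k : ℕ) : ℝ) := by push_cast; ring
  rw [hN₁.measureReal_stableTime_eq hl₁ ha₁ hT₁ (hNT.comp measurable_fst measurable_fst),
    hN₂.measureReal_stableTime_eq hl₂ ha₂ hT₂ (hNT.comp measurable_snd measurable_snd), h_param,
    pow_add]
  generalize foxWright _ _ _ = A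
  generalize foxWright _ _ _ = B
  linear_combination (-((-1) ^ k / ((n ! : ℝ) * ((n + k)! : ℝ)) * A * B)) * h_sign

theorem mainTheorem4_general [IsProbabilityMeasure P] (hl₁ : 0 < l₁) (hl₂ : 0 < l₂)
    (ha₁ : 0 ≤ a₁) (ha₂ : 0 ≤ a₂) (hN₁ : HasPoissonMarginals P l₁ N₁)
    (hN₂ : HasPoissonMarginals P l₂ N₂) (hT₁ : HasStableLaplace P a₁ c₁ T₁)
    (hT₂ : HasStableLaplace P a₂ c₂ T₂)
    (hN : IndepFun (fun ω d => N₁ d ω) (fun ω d => N₂ d ω) P) (hT : IndepFun T₁ T₂ P)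
    (hNT : IndepFun (fun ω => ((N₁ · ω), (N₂ · ω))) (fun ω => (T₁ ω, T₂ ω)) P) :
    (∀ m : ℕ,
      Summable (foxWrightTerm ![(1, a₁)] ![(1 - (m : ℝ), a₁)] (-(l₁ : ℝ) ^ a₁ * c₁)) ∧
      Summable (foxWrightTerm ![(1, a₂)] ![(1 - (m : ℝ), a₂)] (-(l₂ : ℝ) ^ a₂ * c₂))) ∧
    ∀ k : ℤ,
      (0 ≤ k → HasSum (fun n : ℕ =>
        (-1 : ℝ) ^ k.natAbs / ((n ! : ℝ) * ((n + k.natAbs)! : ℝ)) *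
          foxWright ![(1, a₁)] ![(1 - (n : ℝ) - (k : ℝ), a₁)] (-(l₁ : ℝ) ^ a₁ * c₁) *
          foxWright ![(1, a₂)] ![(1 - (n : ℝ), a₂)] (-(l₂ : ℝ) ^ a₂ * c₂))
        (P.real {ω | (N₁ (T₁ ω) ω : ℤ) - N₂ (T₂ ω) ω = k})) ∧
      (k < 0 → HasSum (fun n : ℕ =>
        (-1 : ℝ) ^ k.natAbs / ((n ! : ℝ) * ((n + k.natAbs)! : ℝ)) *
          foxWright ![(1, a₁)] ![(1 - (n : ℝ), a₁)] (-(l₁ : ℝ) ^ a₁ * c₁) *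
          foxWright ![(1, a₂)] ![(1 - (n : ℝ) - |(k : ℝ)|, a₂)] (-(l₂ : ℝ) ^ a₂ * c₂))
        (P.real {ω | (N₁ (T₁ ω) ω : ℤ) - N₂ (T₂ ω) ω = k})) := by
  refine ⟨fun m => ⟨summable_foxWrightTerm_one_sub_natCast ha₁ m _,
    summable_foxWrightTerm_one_sub_natCast ha₂ m _⟩, fun k => ⟨fun hk => ?_, fun hk => ?_⟩⟩
  · lift k to ℕ using hk
    exact hasSum_foxWright_stableTime_sub_eq hl₁ hl₂ ha₁ ha₂ hN₁ hN₂ hT₁ hT₂ hN hT hNT k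
  · obtain ⟨j, rfl⟩ : ∃ j : ℕ, k = -(j : ℤ) := ⟨k.natAbs, by omega⟩
    have h_set : {ω | (N₁ (T₁ ω) ω : ℤ) - N₂ (T₂ ω) ω = -(j : ℤ)} =
        {ω | (N₂ (T₂ ω) ω : ℤ) - N₁ (T₁ ω) ω = j} := by
      ext ω
      rw [Set.mem_ofPred_eq, Set.mem_ofPred_eq, ← neg_inj, neg_sub, neg_neg]
    have h_swap := hasSum_foxWright_stableTime_sub_eq hl₂ hl₁ ha₂ ha₁ hN₂ hN₁ hT₂ hT₁ hN.symm
      hT.symm (hNT.comp measurable_swap measurable_swap) j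
    rw [h_set]
    refine h_swap.congr_fun fun n => ?_
    rw [Int.cast_neg, Int.cast_natCast, abs_neg, Nat.abs_cast, Int.natAbs_neg,
      Int.natAbs_natCast, mul_right_comm]

end SubordinatedPoisson

theorem mainTheorem4 {Ω : Type*} [MeasurableSpace Ω] (P : Measure Ω) [IsProbabilityMeasure P]
    (l₁ l₂ : ℝ≥0) (hl₁ : 0 < l₁) (hl₂ : 0 < l₂)
    (a₁ a₂ : ℝ) (ha₁ : a₁ ∈ Set.Ioo (0 : ℝ) 1) (ha₂ : a₂ ∈ Set.Ioo (0 : ℝ) 1)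
    (N₁ N₂ : ℝ≥0 → Ω → ℕ) (D₁ D₂ : ℝ≥0 → Ω → ℝ≥0) (S : ℝ≥0 → Ω → ℤ)
    (hS : IsSpaceFractionalSkellam P l₁ l₂ a₁ a₂ N₁ N₂ D₁ D₂ S) (t : ℝ≥0) :
    -- the Fox-Wright series that occur below converge absolutely
    (∀ m : ℕ,
      Summable (foxWrightTerm ![(1, a₁)] ![(1 - (m : ℝ), a₁)] (-(l₁ : ℝ) ^ a₁ * t)) ∧
      Summable (foxWrightTerm ![(1, a₂)] ![(1 - (m : ℝ), a₂)] (-(l₂ : ℝ) ^ a₂ * t))) ∧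
    ∀ k : ℤ,
      (0 ≤ k → HasSum (fun n : ℕ =>
        (-1 : ℝ) ^ k.natAbs / ((n ! : ℝ) * ((n + k.natAbs)! : ℝ)) *
          foxWright ![(1, a₁)] ![(1 - (n : ℝ) - (k : ℝ), a₁)] (-(l₁ : ℝ) ^ a₁ * t) *
          foxWright ![(1, a₂)] ![(1 - (n : ℝ), a₂)] (-(l₂ : ℝ) ^ a₂ * t))
        (P.real {ω | S t ω = k})) ∧
      (k < 0 → HasSum (fun n : ℕ =>
        (-1 : ℝ) ^ k.natAbs / ((n ! : ℝ) * ((n + k.natAbs)! : ℝ)) *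
          foxWright ![(1, a₁)] ![(1 - (n : ℝ), a₁)] (-(l₁ : ℝ) ^ a₁ * t) *
          foxWright ![(1, a₂)] ![(1 - (n : ℝ) - |(k : ℝ)|, a₂)] (-(l₂ : ℝ) ^ a₂ * t))
        (P.real {ω | S t ω = k})) := by
  obtain ⟨hN₁, hN₂, hD₁, hD₂, hN, hD, hND, rfl⟩ := hS
  have h_time : Measurable fun x : ℝ≥0 → ℝ≥0 => x t := measurable_pi_apply t
  exact mainTheorem4_general hl₁ hl₂ ha₁.1.le ha₂.1.le hN₁.hasPoissonMarginals
    hN₂.hasPoissonMarginals (hD₁.hasStableLaplace t) (hD₂.hasStableLaplace t) hN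
    (hD.comp h_time h_time) (hND.comp measurable_id (h_time.prodMap h_time))
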